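/- Let $K$ be an oriented virtual knot, given by any diagram (Gauss diagram) with a chosen base point. Let $\mathrm{Zh}(K)=K\cup\omega$ be the two-component diagram in which the new component $\omega$ passes over both strands at each classical crossing of $K$, with a crossing of sign $\varepsilon$ over the lower strand just before the crossing and one of sign $-\varepsilon$ over the upper strand just after it, where $\varepsilon$ is the sign of the crossing of $K$. For a non-empty sequence $J$ in $\{1,2\}$ let $$\overline{\mathrm{zh}}_J(K)=\bar\mu_{J|1}(\mathrm{Zh}(K))\in\mathbb Z/\Delta_{J|1}$$ be the Milnor invariant of $\mathrm{Zh}(K)$: the Magnus coefficient $\epsilon_J(\phi^{(q)}(\widetilde\lambda))$, $q>|J|$, of the longitude word $\widetilde\lambda$ of the component $K$ of $\mathrm{Zh}(K)$, where $\phi^{(q)}$ is Milnor's map from the free group on the arcs of $\mathrm{Zh}(K)$ to the free group on two letters, taken modulo the greatest common divisor $\Delta_{J|1}$ of the integers $\mu$ of all sequences of length at least $2$ obtained from $J|1$ by deleting at least one term and cyclically permuting the others (with $\mathbb Z/0=\mathbb Z$). Let $\widetilde G(K)$ be the extended group of $K$: its generators are the short arcs of the diagram and one further generator $v$, and its relations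 are, at each classical crossing with incoming and outgoing upper short arcs $a,c$ and incoming and outgoing lower short arcs $b,d$, $c=vav^{-1},\ d=a^{-1}v^{-1}bva$ if the crossing is positive, and $c=v^{-1}av,\ d=avbv^{-1}a^{-1}$ if it is negative. The generalized Alexander polynomial of $K$ is the greatest common divisor, defined up to units of $\mathbb Z[t^{\pm1},v^{\pm1}]$, of the codimension one minors of the Alexander matrix (matrix of Fox derivatives) of this presentation, where all short arcs are sent to $t$ and $v$ is sent to $v$. If $\overline{\mathrm{zh}}_J(K)=0$ for all non-empty sequences $J$ in $\{1,2\}$, then the generalized Alexander polynomial of $K$ is trivial, i.e. equal to $0$. Equivalently, if the generalized Alexander polynomial of $K$ is non-zero, then some $\overline{\mathrm{zh}}_J(K)$ is non-zero. -/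

import Mathlib

/-! ### Virtual link diagrams -/

/-- The two ways in which a strand of a link diagram goes through a classical crossing. -/
inductive Strand
  | over
  | under

/-- An oriented virtual link diagram with `m` ordered components, recorded by its Gauss diagram
(virtual crossings carry no data, so that detour moves do nothing).  The `i`-th component is a circle
with a base point; starting there and following the orientation one meets the classical
crossings at the points `⟨i, 0⟩, ⟨i, 1⟩, …, ⟨i, len i - 1⟩`.  The bijection `passage` says which
crossing is met at each point, and on which of its two strands.  `sign` is the sign of a crossing:
`1` if right-handed, `-1` if left-handed. A virtual knot diagram is a `GaussDiagram 1`. -/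
structure GaussDiagram (m : ℕ) where
  Crossing : Type
  sign : Crossing → ℤˣ
  len : Fin m → ℕ
  passage : (Σ i : Fin m, Fin (len i)) ≃ Crossing × Strand

namespace GaussDiagram

/-! ### Arcs, longitude words -/

/-- The crossings at which the `i`-th component passes under, among the first `k` points of that
component, in the order in which they are met. -/
def undersBefore {m : ℕ} (L : GaussDiagram m) (i : Fin m) (k : ℕ) : List L.Crossing :=
  ((List.finRange (L.len i)).take k).filterMap fun p =>
    match L.passage ⟨i, p⟩ with
    | (c, Strand.under) => some c
    | (_, Strand.over) => none

/-- All undercrossings of the `i`-th component, in the order in which they are met. -/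
def unders {m : ℕ} (L : GaussDiagram m) (i : Fin m) : List L.Crossing :=
  L.undersBefore i (L.len i)

/-- The number of arcs of the `i`-th component: the number of its undercrossings, or `1` if there
are none (the value is `max 1 n`, written in a form that is visibly a successor). -/
abbrev numArcs {m : ℕ} (L : GaussDiagram m) (i : Fin m) : ℕ := (L.unders i).length - 1 + 1

/-- The arcs of the diagram, going from one undercrossing to the next. `⟨i, 0⟩` is the arc that
contains the base point of the `i`-th component, and `⟨i, j⟩` is the arc reached from it after
passing `j` undercrossings, with `j` read modulo the number of arcs. -/
abbrev Arc {m : ℕ} (L : GaussDiagram m) : Type := Σ i : Fin m, Fin (L.numArcs i)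

/-- The initial arc of a component. -/
def initialArc {m : ℕ} (L : GaussDiagram m) (i : Fin m) : L.Arc := ⟨i, 0⟩

/-- The arc that passes over at a given crossing. -/
def overArc {m : ℕ} (L : GaussDiagram m) (c : L.Crossing) : L.Arc :=
  ⟨(L.passage.symm (c, Strand.over)).1,
    Fin.ofNat _ (L.undersBefore (L.passage.symm (c, Strand.over)).1
      (L.passage.symm (c, Strand.over)).2).length⟩

/-- The word `l_{i,j} = w_{i,1} w_{i,2} ⋯ w_{i,j}`, where `w_{i,k} = z ^ ε` for the overcrossing arc
`z` and the sign `ε` of the `k`-th undercrossing of the `i`-th component. The relation of the link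
group at that crossing is `c_{i,k+1} = w_{i,k}⁻¹ c_{i,k} w_{i,k}`. -/
def partialWord {m : ℕ} (L : GaussDiagram m) (i : Fin m) (j : ℕ) : FreeGroup L.Arc :=
  (((L.unders i).take j).map fun c => FreeGroup.of (L.overArc c) ^ (L.sign c : ℤ)).prod

/-- The parallel word of the `i`-th component, read from its base point all the way around. -/
def parallelWord {m : ℕ} (L : GaussDiagram m) (i : Fin m) : FreeGroup L.Arc :=
  L.partialWord i (L.unders i).length

/-- The exponent sum, in a word in the arcs, of the arcs of the `i`-th component. -/
def exponentSum {m : ℕ} (L : GaussDiagram m) (i : Fin m) (w : FreeGroup L.Arc) : ℤ :=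
  Multiplicative.toAdd
    (FreeGroup.lift (fun a : L.Arc => Multiplicative.ofAdd (if a.1 = i then (1 : ℤ) else 0)) w)

/-- The longitude word of the `i`-th component: the parallel word multiplied by the power of
the initial arc that makes the exponent sum of the arcs of this component zero. -/
def longitudeWord {m : ℕ} (L : GaussDiagram m) (i : Fin m) : FreeGroup L.Arc :=
  L.parallelWord i * FreeGroup.of (L.initialArc i) ^ (-L.exponentSum i (L.parallelWord i))

/-! ### Milnor's invariants -/

/-- Milnor's maps `p^(q)` for `q ≥ 1`: `p^(1)` is the identity and
`p^(q+1) (c_{i,j+1}) = p^(q) (l_{i,j}⁻¹ c_{i,1} l_{i,j})` (for `j = 0` this says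
`p^(q+1) (c_{i,1}) = c_{i,1}`). The value at `q = 0` is not used. -/
def milnorMap {m : ℕ} (L : GaussDiagram m) : ℕ → (FreeGroup L.Arc →* FreeGroup L.Arc)
  | 0 => MonoidHom.id _
  | 1 => MonoidHom.id _
  | q + 2 => FreeGroup.lift fun a : L.Arc =>
      milnorMap L (q + 1)
        ((L.partialWord a.1 a.2)⁻¹ * FreeGroup.of (L.initialArc a.1) * L.partialWord a.1 a.2)

/-- The map `φ^(q)` to the free group on one letter for each component: `p^(q)`
followed by sending every arc to the letter of its component. -/
def phi {m : ℕ} (L : GaussDiagram m) (q : ℕ) : FreeGroup L.Arc →* FreeGroup (Fin m) :=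
  (FreeGroup.lift fun a : L.Arc => FreeGroup.of a.1).comp (L.milnorMap q)

end GaussDiagram

/-- The coefficient of the noncommutative monomial `I` in the power series of a letter:
`x ↦ 1 + x` and `x⁻¹ ↦ 1 - x + x² - ⋯`. The letter is `x` if the second entry of the pair is `true`
and `x⁻¹` if it is `false`. -/
def magnusLetter {X : Type} [DecidableEq X] : X × Bool → List X → ℤ
  | (x, true), I => if I = [] ∨ I = [x] then 1 else 0
  | (x, false), I => if ∀ y ∈ I, y = x then (-1) ^ I.length else 0

/-- The coefficient of the monomial `I` in the product of the power series of the letters of a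
word. -/
def magnusWord {X : Type} [DecidableEq X] : List (X × Bool) → List X → ℤ
  | [], I => if I = [] then 1 else 0
  | s :: w, I => ∑ k ∈ Finset.range (I.length + 1),
      magnusLetter s (I.take k) * magnusWord w (I.drop k)

/-- The coefficient `ε_I(f)` of the Magnus expansion of an element of a free group. -/
def magnusCoeff {X : Type} [DecidableEq X] (I : List X) (f : FreeGroup X) : ℤ :=
  magnusWord f.toWord I

namespace GaussDiagram

/-- The integers `μ_{J|j}(L) = ε_J (φ^(q) (λ_j))` with `q = |J| + 1`, for `I = J|j`. The value at the
empty sequence is not used. -/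
def mu {m : ℕ} (L : GaussDiagram m) (I : List (Fin m)) : ℤ :=
  if h : I = [] then 0
  else magnusCoeff I.dropLast (L.phi I.length (L.longitudeWord (I.getLast h)))

/-- The indeterminacy `Δ_I`: the greatest common divisor of the `μ` of all sequences of length at
least two obtained from `I` by deleting at least one term and cyclically permuting the rest (the
greatest common divisor of nothing is `0`). -/
def indeterminacy {m : ℕ} (L : GaussDiagram m) (I : List (Fin m)) : ℕ :=
  ((I.sublists.toFinset.filter fun I' => 2 ≤ I'.length ∧ I'.length < I.length).biUnion
    fun I' => I'.cyclicPermutations.toFinset).gcd fun I'' => (L.mu I'').natAbs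

/-- Milnor's residue classes: `μ_I(L)` modulo `Δ_I`. -/
def muBar {m : ℕ} (L : GaussDiagram m) (I : List (Fin m)) : ZMod (L.indeterminacy I) :=
  (L.mu I : ZMod (L.indeterminacy I))

/-! ### The `Zh` map -/

/-- The points of a virtual knot diagram, without the index of its only component. -/
def knotPassage (K : GaussDiagram 1) : Fin (K.len 0) ≃ K.Crossing × Strand :=
  (Equiv.uniqueSigma fun i : Fin 1 => Fin (K.len i)).symm.trans K.passage

/-- The points of `Zh(K) = K ∪ ω` and the strands at them. At each point of `K`, with strand `p`,
the new component `ω` crosses over `K` at the crossing `Sum.inr p`: just before the crossing of `K` if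
`K` passes under there, and just after it if `K` passes over there. So the `k`-th point of `K`
becomes the points `2k` and `2k+1` of the first component (`finProdFinEquiv (k, s) = 2k + s`).
On the second component `ω` the new crossings are met in the order of the points of `K`. -/
def zhPassage (K : GaussDiagram 1) :
    (Σ i : Fin 2, Fin (![K.len 0 * 2, K.len 0] i)) ≃
      (K.Crossing ⊕ (K.Crossing × Strand)) × Strand where
  toFun
    | ⟨0, k⟩ =>
      match K.knotPassage (finProdFinEquiv.symm k).1, (finProdFinEquiv.symm k).2 with
      | (c, Strand.over), 0 => (Sum.inl c, Strand.over)
      | (c, Strand.over), 1 => (Sum.inr (c, Strand.over), Strand.under)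
      | (c, Strand.under), 0 => (Sum.inr (c, Strand.under), Strand.under)
      | (c, Strand.under), 1 => (Sum.inl c, Strand.under)
    | ⟨1, k⟩ => (Sum.inr (K.knotPassage k), Strand.over)
  invFun
    | (Sum.inl c, Strand.over) => ⟨0, finProdFinEquiv (K.knotPassage.symm (c, Strand.over), 0)⟩
    | (Sum.inl c, Strand.under) => ⟨0, finProdFinEquiv (K.knotPassage.symm (c, Strand.under), 1)⟩
    | (Sum.inr (c, Strand.over), Strand.under) =>
        ⟨0, finProdFinEquiv (K.knotPassage.symm (c, Strand.over), 1)⟩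
    | (Sum.inr (c, Strand.under), Strand.under) =>
        ⟨0, finProdFinEquiv (K.knotPassage.symm (c, Strand.under), 0)⟩
    | (Sum.inr p, Strand.over) => ⟨1, K.knotPassage.symm p⟩
  left_inv := by
    rintro ⟨i, k⟩
    fin_cases i
    · obtain ⟨⟨k, s⟩, rfl⟩ := finProdFinEquiv.surjective k
      obtain ⟨⟨c, b⟩, rfl⟩ := K.knotPassage.symm.surjective k
      cases b <;> fin_cases s <;> simp
    · obtain ⟨⟨c, b⟩, rfl⟩ := K.knotPassage.symm.surjective k
      cases b <;> simp
  right_inv := by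
    rintro ⟨c | ⟨c, b⟩, b'⟩
    · cases b' <;> simp
    · cases b <;> cases b' <;> simp

/-- The two-component diagram `Zh(K) = K ∪ ω`. The first component is `K`, the second is `ω`.
At a crossing of `K` with sign `ε`, the arc of `ω` that passes over both strands has a crossing of
sign `ε` with the lower strand and one of sign `-ε` with the upper strand. -/
def zh (K : GaussDiagram 1) : GaussDiagram 2 where
  Crossing := K.Crossing ⊕ (K.Crossing × Strand)
  sign
    | Sum.inl c => K.sign c
    | Sum.inr (c, Strand.under) => K.sign c
    | Sum.inr (c, Strand.over) => -K.sign c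
  len := ![K.len 0 * 2, K.len 0]
  passage := K.zhPassage

/-- The invariant `zh-bar_J(K) = μ-bar_{J|1}(Zh(K))`, for a sequence `J` in the two components of `Zh(K)`
(`0 : Fin 2` stands for `K` and `1 : Fin 2` for `ω`). -/
def zhBar (K : GaussDiagram 1) (J : List (Fin 2)) : ZMod (K.zh.indeterminacy (J ++ [0])) :=
  K.zh.muBar (J ++ [0])

/-! ### The extended group and the generalized Alexander polynomial -/

/-- The short arcs of a virtual knot diagram, going from one classical crossing to the next: short
arc `k` ends at the `k`-th point. A diagram without crossings has one short arc. -/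
abbrev ShortArc (K : GaussDiagram 1) : Type := Fin (K.len 0 - 1 + 1)

/-- The generators of the extended group: the short arcs, and the auxiliary variable `v`, which
is `none`. -/
abbrev ExtGen (K : GaussDiagram 1) : Type := Option K.ShortArc

/-- The short arc that comes into a given passage. -/
def arcIn (K : GaussDiagram 1) (p : K.Crossing × Strand) : FreeGroup K.ExtGen :=
  FreeGroup.of (some (Fin.ofNat _ (K.knotPassage.symm p)))

/-- The short arc that leaves a given passage (after the last point one is back at short arc
`0`). -/
def arcOut (K : GaussDiagram 1) (p : K.Crossing × Strand) : FreeGroup K.ExtGen :=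
  FreeGroup.of (some (Fin.ofNat _ (K.knotPassage.symm p + 1)))

/-- The relators `y⁻¹ w⁻¹ x w` of the extended group, two for each crossing, where `x` comes in and
`y` goes out. On the upper strand of a crossing of sign `ε` one has `w = v ^ (-ε)`; on the lower strand
`w = v ^ ε z ^ ε`, with `z` the incoming short arc of the upper strand. So, with `a` and `c` the
incoming and outgoing upper short arcs and `b` and `d` the lower ones, the relations are
`c = v a v⁻¹`, `d = a⁻¹ v⁻¹ b v a` at a positive crossing and
`c = v⁻¹ a v`, `d = a v b v⁻¹ a⁻¹` at a negative one. -/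
def extRelator (K : GaussDiagram 1) : K.Crossing × Strand → FreeGroup K.ExtGen
  | (c, Strand.over) =>
      let w : FreeGroup K.ExtGen := FreeGroup.of none ^ (-(K.sign c : ℤ))
      (K.arcOut (c, Strand.over))⁻¹ * w⁻¹ * K.arcIn (c, Strand.over) * w
  | (c, Strand.under) =>
      let w : FreeGroup K.ExtGen :=
        FreeGroup.of none ^ (K.sign c : ℤ) * K.arcIn (c, Strand.over) ^ (K.sign c : ℤ)
      (K.arcOut (c, Strand.under))⁻¹ * w⁻¹ * K.arcIn (c, Strand.under) * w

end GaussDiagram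

/-- The Fox derivative with respect to the generator `j` of a word, where the letter `x` is
written `(x, true)` and `x⁻¹` is written `(x, false)`. It is determined by `∂x/∂j = δ`,
`∂x⁻¹/∂j = -x⁻¹ δ` and the rule `∂(u w) = ∂u + u ∂w`. -/
noncomputable def foxWord {X : Type} [DecidableEq X] (j : X) :
    List (X × Bool) → MonoidAlgebra ℤ (FreeGroup X)
  | [] => 0
  | (x, true) :: w =>
      (if x = j then 1 else 0) + MonoidAlgebra.of ℤ (FreeGroup X) (FreeGroup.of x) * foxWord j w
  | (x, false) :: w =>
      -(if x = j then MonoidAlgebra.of ℤ (FreeGroup X) (FreeGroup.of x)⁻¹ else 0) +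
        MonoidAlgebra.of ℤ (FreeGroup X) (FreeGroup.of x)⁻¹ * foxWord j w

/-- The Fox derivative `∂f/∂j` of an element of a free group. -/
noncomputable def foxDeriv {X : Type} [DecidableEq X] (j : X) (f : FreeGroup X) :
    MonoidAlgebra ℤ (FreeGroup X) :=
  foxWord j f.toWord

/-- The ring `ℤ[t, t⁻¹, v, v⁻¹]`, as the group ring of `ℤ²`. -/
abbrev LaurentTV : Type := MonoidAlgebra ℤ (Multiplicative (ℤ × ℤ))

/-- `Δ` is a greatest common divisor of the minors of size `c - k` of the matrix `M`, where `c` is the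
number of columns. There are no nonzero minors, and `Δ = 0`, if `M` has fewer than `c - k` rows. -/
def IsGCDOfMinors {R ι κ : Type} [CommRing R] [Fintype κ] (M : Matrix ι κ R) (k : ℕ) (Δ : R) :
    Prop :=
  ∀ d : R, d ∣ Δ ↔
    ∀ (f : Fin (Fintype.card κ - k) → ι) (g : Fin (Fintype.card κ - k) → κ),
      d ∣ (M.submatrix f g).det

namespace GaussDiagram

/-- The map from the generators of the extended group to `ℤ²`: every short arc goes to `t`, and the
auxiliary variable goes to `v`. -/
def extAbel (K : GaussDiagram 1) : FreeGroup K.ExtGen →* Multiplicative (ℤ × ℤ) :=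
  FreeGroup.lift fun
    | some _ => Multiplicative.ofAdd (1, 0)
    | none => Multiplicative.ofAdd (0, 1)

/-- The Alexander matrix of the extended group: the Fox derivatives of the relators with respect to
the generators, with coefficients in `ℤ[t, t⁻¹, v, v⁻¹]`. -/
noncomputable def extAlexanderMatrix (K : GaussDiagram 1) :
    Matrix (K.Crossing × Strand) K.ExtGen LaurentTV :=
  Matrix.of fun p x => MonoidAlgebra.mapDomainRingHom ℤ K.extAbel (foxDeriv x (K.extRelator p))

/-- `Δ` is the generalized Alexander polynomial of `K`, which is defined up to units: the greatest
common divisor of the codimension one minors of the Alexander matrix of the extended group. -/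
def IsGeneralizedAlexanderPolynomial (K : GaussDiagram 1) (Δ : LaurentTV) : Prop :=
  IsGCDOfMinors K.extAlexanderMatrix 1 Δ

end GaussDiagram

/-! ### Milnor's maps modulo the lower central series -/

namespace GaussDiagram

variable {m : ℕ} (L : GaussDiagram m)

/-! Reading `v` as the meridian of `ω` turns the relations of the extended group into the Wirtinger
relations of `Zh(K)` along `K`. If all the invariants vanish, the longitude of `K` becomes trivial
in every nilpotent quotient of the free group on `x₀`, `x₁`, so the extended group maps onto each of
these quotients as if `K` were an unlinked component. Such a group is too large for its Alexander
matrix to have a nonzero codimension one minor.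

Vanishing residues first give vanishing integers `μ` (`zh_mu_append_zero`). Then `extPhi` kills the
extended relators modulo any normal subgroup that contains a lower central term and the image of the
longitude (`extPhi_extRelator_mem`).

Let `I` be the augmentation ideal of `ℤ[t^±1, v^±1]`. The affine representation `affineHom` is
trivial modulo `I`, so it sends deep lower central terms, and elements without Magnus coefficients
of low positive degree, to matrices near `1` in the `I`-adic sense
(`mem_filtration_of_magnusCoeff_eq_zero`). Its translation part, pulled back along `extPhi`, is a
derivation. For each `q`, its values on the generators form a vector that the Alexander matrix sends
into `I ^ q`, with entry `0` at `v` and the fixed nonzero entry `t - 1` at the first short arc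
(`exists_sum_extAlexanderMatrix_mem`).

By Cramer's rule, a minor on the short-arc columns times `t - 1` lies in every `I ^ q`, so it is
zero by Krull's intersection theorem. The fundamental formula of Fox calculus carries this over to
minors that use the column of `v`. -/

theorem partialWord_zero (i : Fin m) : L.partialWord i 0 = 1 := by
  simp [partialWord]

theorem phi_of_initialArc (i : Fin m) (q : ℕ) :
    L.phi q (FreeGroup.of (L.initialArc i)) = FreeGroup.of i := by
  suffices h : L.milnorMap q (FreeGroup.of (L.initialArc i)) = FreeGroup.of (L.initialArc i) by
    rw [phi, MonoidHom.comp_apply, h]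
    simp [initialArc]
  induction q using Nat.twoStepInduction with
  | zero => rfl
  | one => rfl
  | more q _ ih =>
    have h0 : L.partialWord (L.initialArc i).1 ((L.initialArc i).2 : ℕ) = 1 :=
      L.partialWord_zero i
    simp only [milnorMap, FreeGroup.lift_apply_of, h0]
    simp only [inv_one, one_mul, mul_one]
    exact ih

theorem phi_of (q : ℕ) (a : L.Arc) :
    L.phi (q + 2) (FreeGroup.of a) =
      (L.phi (q + 1) (L.partialWord a.1 a.2))⁻¹ * FreeGroup.of a.1 *
        L.phi (q + 1) (L.partialWord a.1 a.2) := by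
  have h := L.phi_of_initialArc a.1 (q + 1)
  rw [← h, ← map_inv, ← map_mul, ← map_mul]
  simp [phi, milnorMap]

/-- Milnor's maps stabilise along the lower central series. -/
theorem phi_inv_mul_phi_succ_mem (n : ℕ) (w : FreeGroup L.Arc) :
    (L.phi (n + 1) w)⁻¹ * L.phi (n + 2) w ∈
      (⊤ : Subgroup (FreeGroup (Fin m))).lowerCentralSeries n := by
  induction n generalizing w with
  | zero => exact Subgroup.mem_top _
  | succ n ih =>
    rw [← QuotientGroup.eq]
    suffices h : (QuotientGroup.mk' _).comp (L.phi (n + 1 + 1)) =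
        (QuotientGroup.mk' ((⊤ : Subgroup (FreeGroup (Fin m))).lowerCentralSeries (n + 1))).comp
          (L.phi (n + 1 + 2)) from DFunLike.congr_fun h w
    refine FreeGroup.ext_hom _ _ fun a => ?_
    refine QuotientGroup.eq.2 ?_
    obtain ⟨g, hg, hB⟩ : ∃ g ∈ (⊤ : Subgroup (FreeGroup (Fin m))).lowerCentralSeries n,
        L.phi (n + 2) (L.partialWord a.1 a.2) = L.phi (n + 1) (L.partialWord a.1 a.2) * g :=
      ⟨_, ih (L.partialWord a.1 a.2), by group⟩
    rw [L.phi_of (n + 1) a, L.phi_of n a, hB, Subgroup.lowerCentralSeries_succ]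
    generalize L.phi (n + 1) (L.partialWord a.1 a.2) = A
    generalize FreeGroup.of a.1 = x
    have := Subgroup.commutator_mem_commutator
      (inv_mem hg) (Subgroup.mem_top (A⁻¹ * x * A)⁻¹)
    rw [← inv_mem_iff]
    convert this using 1
    simp only [commutatorElement_def]
    group

theorem phi_eq_phi_mod {H : Subgroup (FreeGroup (Fin m))} {n : ℕ}
    (hH : (⊤ : Subgroup (FreeGroup (Fin m))).lowerCentralSeries n ≤ H) (k : ℕ)
    (w : FreeGroup L.Arc) : (L.phi (n + 1) w)⁻¹ * L.phi (n + k + 1) w ∈ H := by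
  induction k with
  | zero => simp
  | succ k ih =>
    have h := H.mul_mem ih (hH (Subgroup.lowerCentralSeries_antitone _ (Nat.le_add_right n k)
      (L.phi_inv_mul_phi_succ_mem (n + k) w)))
    convert h using 1
    group

end GaussDiagram

/-! ### Filtered rings and the lower central series -/

section Filtration

variable {S G : Type*} [Ring S] [Group G] (F : ℕ → AddSubgroup S)
  (hmul : ∀ i j x y, x ∈ F i → y ∈ F j → x * y ∈ F (i + j)) (ψ : G →* Sˣ)
  (h0 : ∀ g, (ψ g : S) ∈ F 0)

/-- The elements of a group that a representation in a filtered ring sends into `1 + F k`. -/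
def filtrationSubgroup (k : ℕ) : Subgroup G where
  carrier := {g | (ψ g : S) - 1 ∈ F k}
  one_mem' := by simp
  mul_mem' {a b} ha hb := by
    have h1 := hmul 0 k _ _ (h0 a) hb
    rw [Nat.zero_add] at h1
    have h := (F k).add_mem h1 ha
    have e : (ψ a : S) * ((ψ b : S) - 1) + ((ψ a : S) - 1) = (ψ (a * b) : S) - 1 := by
      simp [mul_sub]
    exact Set.mem_ofPred.2 (e ▸ h)
  inv_mem' {a} ha := by
    have h1 := hmul 0 k _ _ (h0 a⁻¹) ha
    rw [Nat.zero_add] at h1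
    have h := (F k).neg_mem h1
    have e : -((ψ a⁻¹ : S) * ((ψ a : S) - 1)) = (ψ a⁻¹ : S) - 1 := by
      simp [mul_sub]
    exact Set.mem_ofPred.2 (e ▸ h)

theorem mem_filtrationSubgroup {k : ℕ} {g : G} :
    g ∈ filtrationSubgroup F hmul ψ h0 k ↔ (ψ g : S) - 1 ∈ F k := Iff.rfl

theorem filtrationSubgroup_normal (k : ℕ) : (filtrationSubgroup F hmul ψ h0 k).Normal where
  conj_mem n hn g := by
    have h := hmul (0 + k) 0 _ _ (hmul 0 k _ _ (h0 g) hn) (h0 g⁻¹)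
    rw [Nat.zero_add, Nat.add_zero] at h
    rw [mem_filtrationSubgroup]
    convert h using 1
    simp [mul_sub, sub_mul]

theorem lowerCentralSeries_le_filtrationSubgroup (h1 : ∀ g, (ψ g : S) - 1 ∈ F 1) (n : ℕ) :
    (⊤ : Subgroup G).lowerCentralSeries n ≤ filtrationSubgroup F hmul ψ h0 (n + 1) := by
  induction n with
  | zero => exact fun g _ => h1 g
  | succ n ih =>
    rw [Subgroup.lowerCentralSeries_succ, Subgroup.commutator_le]
    intro g hg h _
    have h2 := (F (n + 1 + 1)).sub_mem (hmul _ _ _ _ (ih hg) (h1 h))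
      (Nat.add_comm 1 (n + 1) ▸ hmul _ _ _ _ (h1 h) (ih hg))
    have h3 := hmul _ _ _ _ h2 (h0 (g⁻¹ * h⁻¹))
    rw [mem_filtrationSubgroup]
    convert h3 using 1
    -- The identity behind this is `ghg⁻¹h⁻¹ - 1 = ((g - 1)(h - 1) - (h - 1)(g - 1)) g⁻¹h⁻¹`.
    have e1 : ((ψ g : S) - 1) * ((ψ h : S) - 1) - ((ψ h : S) - 1) * ((ψ g : S) - 1) =
        (ψ (g * h) : S) - ψ (h * g) := by
      simp only [map_mul, Units.val_mul]; noncomm_ring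
    rw [e1, sub_mul, ← Units.val_mul, ← Units.val_mul, ← map_mul, ← map_mul, commutatorElement_def]
    simp [mul_assoc]

end Filtration

/-! ### The Magnus expansion through operators on power series -/

section Magnus

variable {X : Type} [DecidableEq X]

/-- Left multiplication by `1 + x` on noncommutative power series. -/
def magnusOp (x : X) : Module.End ℤ (List X → ℤ) where
  toFun g
    | [] => g []
    | y :: I => g (y :: I) + if y = x then g I else 0
  map_add' f g := by
    funext I
    rcases I with _ | ⟨y, I⟩
    · rfl
    · by_cases h : y = x <;> simp [h]; ring
  map_smul' c g := by
    funext I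
    rcases I with _ | ⟨y, I⟩
    · rfl
    · by_cases h : y = x <;> simp [h]; ring

/-- Left multiplication of the power series `g` by `(1 + x)⁻¹`. -/
def magnusInvFun (x : X) (g : List X → ℤ) : List X → ℤ
  | [] => g []
  | y :: I => g (y :: I) - if y = x then magnusInvFun x g I else 0

/-- Left multiplication by `(1 + x)⁻¹` on noncommutative power series. -/
def magnusInvOp (x : X) : Module.End ℤ (List X → ℤ) where
  toFun := magnusInvFun x
  map_add' f g := by
    funext I
    induction I with
    | nil => rfl
    | cons y I ih =>
      by_cases h : y = x
      · simp [magnusInvFun, h] at ih ⊢; rw [ih]; ring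
      · simp [magnusInvFun, h]
  map_smul' c g := by
    funext I
    induction I with
    | nil => rfl
    | cons y I ih =>
      by_cases h : y = x
      · simp [magnusInvFun, h] at ih ⊢; rw [ih]; ring
      · simp [magnusInvFun, h]

@[simp] theorem magnusOp_nil (x : X) (g : List X → ℤ) : magnusOp x g [] = g [] := rfl

@[simp] theorem magnusOp_cons (x : X) (g : List X → ℤ) (y : X) (I : List X) :
    magnusOp x g (y :: I) = g (y :: I) + if y = x then g I else 0 := rfl

@[simp] theorem magnusInvOp_nil (x : X) (g : List X → ℤ) : magnusInvOp x g [] = g [] := rfl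

@[simp] theorem magnusInvOp_cons (x : X) (g : List X → ℤ) (y : X) (I : List X) :
    magnusInvOp x g (y :: I) = g (y :: I) - if y = x then magnusInvOp x g I else 0 := rfl

/-- The action of a free group on power series through the Magnus expansion. -/
def magnusHom : FreeGroup X →* (Module.End ℤ (List X → ℤ))ˣ :=
  FreeGroup.lift fun x =>
    { val := magnusOp x
      inv := magnusInvOp x
      val_inv := by
        refine LinearMap.ext fun g => funext fun I => ?_
        rcases I with _ | ⟨y, I⟩ <;> simp
      inv_val := by
        refine LinearMap.ext fun g => funext fun I => ?_
        induction I with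
        | nil => rfl
        | cons y I ih =>
          simp only [Module.End.mul_apply, Module.End.one_apply] at ih
          simp [ih] }

@[simp] theorem magnusHom_of (x : X) :
    (magnusHom (FreeGroup.of x) : Module.End ℤ (List X → ℤ)) = magnusOp x := by
  simp [magnusHom]

@[simp] theorem magnusHom_of_inv (x : X) :
    (magnusHom (FreeGroup.of x)⁻¹ : Module.End ℤ (List X → ℤ)) = magnusInvOp x := by
  rw [map_inv]
  simp only [magnusHom, FreeGroup.lift_apply_of]
  rfl

/-- The power series `1`. -/
def magnusOne : List X → ℤ := fun I => if I = [] then 1 else 0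

theorem sum_magnusLetter_true (x : X) (g : List X → ℤ) (I : List X) :
    ∑ k ∈ Finset.range (I.length + 1), magnusLetter (x, true) (I.take k) * g (I.drop k) =
      magnusOp x g I := by
  rcases I with _ | ⟨y, I⟩
  · simp [magnusLetter]
  · rw [List.length_cons, Finset.sum_range_succ', Finset.sum_range_succ', Finset.sum_eq_zero]
    · by_cases h : y = x <;> simp [magnusLetter, h, add_comm]
    · intro k hk
      rcases I with _ | ⟨z, I⟩
      · simp at hk
      · simp [magnusLetter]

theorem sum_magnusLetter_false (x : X) (g : List X → ℤ) (I : List X) :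
    ∑ k ∈ Finset.range (I.length + 1), magnusLetter (x, false) (I.take k) * g (I.drop k) =
      magnusInvOp x g I := by
  induction I with
  | nil => simp [magnusLetter]
  | cons y I ih =>
    rw [magnusInvOp_cons, ← ih, List.length_cons, Finset.sum_range_succ']
    by_cases h : y = x
    · have h2 : ∀ k, magnusLetter (x, false) (x :: I.take k) =
          -magnusLetter (x, false) (I.take k) := fun k => by
        simp only [magnusLetter, List.mem_cons, forall_eq_or_imp, true_and, List.length_cons]
        split_ifs <;> ring
      simp only [h, List.take_succ_cons, List.drop_succ_cons, h2, if_true, neg_mul,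
        Finset.sum_neg_distrib]
      simp [magnusLetter]
      ring
    · have h2 : ∀ k, magnusLetter (x, false) (y :: I.take k) = 0 := fun k => by
        simp [magnusLetter, h]
      simp only [h, List.take_succ_cons, List.drop_succ_cons, h2]
      simp [magnusLetter]

/-- The recursion for words is a Cauchy product, that is, left multiplication by the series of the
first letter. The right side depends only on the group element, so reduction of words causes no
trouble and multiplicativity becomes available. -/
theorem magnusWord_eq (w : List (X × Bool)) :
    magnusWord w = (magnusHom (FreeGroup.mk w) : Module.End ℤ (List X → ℤ)) magnusOne := by
  induction w with
  | nil => rw [← FreeGroup.one_eq_mk, map_one]; rfl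
  | cons s w ih =>
    obtain ⟨x, b⟩ := s
    have e : FreeGroup.mk ((x, b) :: w) = FreeGroup.mk [(x, b)] * FreeGroup.mk w := by
      simp [FreeGroup.mul_mk]
    rw [e, map_mul, Units.val_mul, Module.End.mul_apply, ← ih]
    funext I
    cases b
    · have e2 : FreeGroup.mk [(x, false)] = (FreeGroup.of x)⁻¹ := by
        simp [FreeGroup.of, FreeGroup.invRev]
      rw [e2, magnusHom_of_inv]
      exact sum_magnusLetter_false x _ I
    · exact (sum_magnusLetter_true x _ I).trans (by rw [← magnusHom_of]; rfl)

theorem magnusCoeff_eq (I : List X) (f : FreeGroup X) :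
    magnusCoeff I f = (magnusHom f : Module.End ℤ (List X → ℤ)) magnusOne I := by
  rw [magnusCoeff, magnusWord_eq, FreeGroup.mk_toWord]

/-- The operators on power series that raise the order by at least `k`. -/
def orderFiltration (X : Type) (k : ℕ) : AddSubgroup (Module.End ℤ (List X → ℤ)) where
  carrier := {T | ∀ (g : List X → ℤ) (n : ℕ), (∀ I, I.length < n → g I = 0) →
    ∀ I, I.length < n + k → T g I = 0}
  zero_mem' := by intro g n _ I _; rfl
  add_mem' {S T} hS hT g n hg I hI := by
    simp [hS g n hg I hI, hT g n hg I hI]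
  neg_mem' {T} hT g n hg I hI := by
    simp [hT g n hg I hI]

omit [DecidableEq X] in
theorem orderFiltration_mul (i j : ℕ) (S T : Module.End ℤ (List X → ℤ))
    (hS : S ∈ orderFiltration X i) (hT : T ∈ orderFiltration X j) :
    S * T ∈ orderFiltration X (i + j) := fun g n hg I hI =>
  hS (T g) (n + j) (hT g n hg) I (by omega)

theorem magnusHom_mem_orderFiltration (f : FreeGroup X) :
    (magnusHom f : Module.End ℤ (List X → ℤ)) ∈ orderFiltration X 0 := by
  induction f using FreeGroup.induction_on with
  | C1 => intro g n hg I hI; simpa using hg I hI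
  | of x =>
    intro g n hg I hI
    rw [magnusHom_of]
    rcases I with _ | ⟨y, I⟩
    · exact hg _ hI
    · simp only [List.length_cons] at hI
      simp [hg (y :: I) hI, hg I (by omega)]
  | inv_of x _ =>
    intro g n hg I hI
    rw [magnusHom_of_inv]
    induction I with
    | nil => exact hg _ hI
    | cons y I ih =>
      simp only [List.length_cons] at hI
      simp [hg (y :: I) hI, ih (by omega)]
  | mul x y hx hy =>
    rw [map_mul, Units.val_mul]
    exact orderFiltration_mul 0 0 _ _ hx hy

theorem magnusHom_sub_one_mem (f : FreeGroup X) :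
    (magnusHom f : Module.End ℤ (List X → ℤ)) - 1 ∈ orderFiltration X 1 := by
  have key : f ∈ filtrationSubgroup (orderFiltration X) orderFiltration_mul magnusHom
      magnusHom_mem_orderFiltration 1 := by
    induction f using FreeGroup.induction_on with
    | C1 => exact one_mem _
    | of x =>
      intro g n hg I hI
      rw [magnusHom_of]
      rcases I with _ | ⟨y, I⟩
      · simp
      · simp only [List.length_cons] at hI
        simp [hg I (by omega)]
    | inv_of x h => exact inv_mem h
    | mul x y hx hy => exact mul_mem hx hy
  exact key

theorem lowerCentralSeries_le_filtrationSubgroup_magnusHom (n : ℕ) :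
    (⊤ : Subgroup (FreeGroup X)).lowerCentralSeries n ≤
      filtrationSubgroup (orderFiltration X) orderFiltration_mul magnusHom
        magnusHom_mem_orderFiltration (n + 1) :=
  lowerCentralSeries_le_filtrationSubgroup _ _ _ _ magnusHom_sub_one_mem n

/-- The series of `g` minus that of `f` is `f · (f⁻¹g - 1)` applied to `1`, which has no terms of
degree at most `|I|`. -/
theorem magnusCoeff_eq_of_inv_mul_mem {I : List X} {f g : FreeGroup X}
    (h : f⁻¹ * g ∈ filtrationSubgroup (orderFiltration X) orderFiltration_mul magnusHom
        magnusHom_mem_orderFiltration (I.length + 1)) :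
    magnusCoeff I g = magnusCoeff I f := by
  have h1 := orderFiltration_mul 0 (I.length + 1) _ _ (magnusHom_mem_orderFiltration f) h
    magnusOne 0 (by simp) I (by omega)
  rw [mul_sub, ← Units.val_mul, ← map_mul, mul_inv_cancel_left, mul_one, LinearMap.sub_apply,
    Pi.sub_apply, ← magnusCoeff_eq, ← magnusCoeff_eq] at h1
  exact sub_eq_zero.1 h1

theorem magnusCoeff_nil (f : FreeGroup X) : magnusCoeff [] f = 1 := by
  have h1 := magnusHom_sub_one_mem f magnusOne 0 (by simp) [] (by simp)
  rw [LinearMap.sub_apply, Pi.sub_apply, ← magnusCoeff_eq, sub_eq_zero] at h1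
  simpa [magnusOne] using h1

theorem magnusCoeff_one {I : List X} (hI : I ≠ []) : magnusCoeff I (1 : FreeGroup X) = 0 := by
  simp [magnusCoeff_eq, magnusOne, hI]

/-- The value of a power series, truncated at degree `q`, at the elements `N x` of a ring. -/
def magnusEval [Fintype X] {S : Type*} [Ring S] (N : X → S) : ℕ → (List X → ℤ) → S
  | 0, _ => 0
  | q + 1, g => (g [] : S) + ∑ x, N x * magnusEval N q fun I => g (x :: I)

section Eval

variable [Fintype X] {S : Type*} [Ring S] (F : ℕ → AddSubgroup S)
  (hmul : ∀ i j x y, x ∈ F i → y ∈ F j → x * y ∈ F (i + j)) (N : X → S) (hN : ∀ x, N x ∈ F 1)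

omit [DecidableEq X] in
theorem magnusEval_zero (q : ℕ) : magnusEval N q 0 = 0 := by
  induction q with
  | zero => rfl
  | succ q ih =>
    have h : ∀ x : X, (magnusEval N q fun I => (0 : List X → ℤ) (x :: I)) = 0 := fun _ => ih
    simp only [magnusEval, h]
    simp

omit [DecidableEq X] in
theorem magnusEval_add (q : ℕ) (f g : List X → ℤ) :
    magnusEval N q (f + g) = magnusEval N q f + magnusEval N q g := by
  induction q generalizing f g with
  | zero => simp [magnusEval]
  | succ q ih =>
    have h : ∀ x : X, (magnusEval N q fun I => (f + g) (x :: I)) =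
        (magnusEval N q fun I => f (x :: I)) + magnusEval N q fun I => g (x :: I) :=
      fun x => ih (fun I => f (x :: I)) fun I => g (x :: I)
    simp only [magnusEval, h, mul_add, Finset.sum_add_distrib]
    rw [Pi.add_apply, Int.cast_add]
    abel

omit [DecidableEq X] in
include hmul hN in
theorem magnusEval_succ_sub_mem (q : ℕ) (hF0 : ∀ n : ℤ, (n : S) ∈ F 0) (g : List X → ℤ) :
    magnusEval N (q + 1) g - magnusEval N q g ∈ F q := by
  induction q generalizing g with
  | zero => simpa [magnusEval] using hF0 (g [])
  | succ q ih =>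
    rw [magnusEval, magnusEval, add_sub_add_left_eq_sub, ← Finset.sum_sub_distrib]
    refine sum_mem fun x _ => ?_
    rw [← mul_sub]
    have h := hmul 1 q _ _ (hN x) (ih fun I => g (x :: I))
    rwa [Nat.add_comm 1 q] at h

include hmul hN in
theorem magnusEval_magnusOp (q : ℕ) (hF0 : ∀ n : ℤ, (n : S) ∈ F 0) (x : X) (g : List X → ℤ) :
    magnusEval N q (magnusOp x g) - (1 + N x) * magnusEval N q g ∈ F q := by
  cases q with
  | zero => simp [magnusEval]
  | succ q =>
    have e : magnusEval N (q + 1) (magnusOp x g) = magnusEval N (q + 1) g +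
        N x * magnusEval N q g := by
      have h : ∀ y : X, (fun I => magnusOp x g (y :: I)) =
          (fun I => g (y :: I)) + if y = x then g else 0 := fun y => by
        funext I; by_cases hy : y = x <;> simp [hy]
      simp only [magnusEval, h, magnusEval_add, mul_add, Finset.sum_add_distrib, magnusOp_nil]
      rw [add_assoc]
      congr 2
      rw [Finset.sum_eq_single x]
      · simp
      · intro y _ hy; simp [hy, magnusEval_zero]
      · simp
    have h := hmul 1 q _ _ (hN x) (magnusEval_succ_sub_mem F hmul N hN q hF0 g)
    rw [Nat.add_comm 1 q, ← neg_mem_iff] at h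
    convert h using 1
    rw [e]
    noncomm_ring

include hmul hN in
-- Substituting `N x` for `x` would intertwine the two actions exactly; truncation at degree `q`
-- costs only an error in `F q`.
theorem magnusEval_magnusHom (ψ : FreeGroup X →* Sˣ) (hF0 : ∀ s : S, s ∈ F 0)
    (hψ : ∀ x, (ψ (FreeGroup.of x) : S) = 1 + N x) (q : ℕ) (f : FreeGroup X)
    (g : List X → ℤ) :
    magnusEval N q ((magnusHom f : Module.End ℤ (List X → ℤ)) g) - ψ f * magnusEval N q g ∈
      F q := by
  induction f using FreeGroup.induction_on generalizing g with
  | C1 => simp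
  | of x =>
    rw [magnusHom_of, hψ]
    exact magnusEval_magnusOp F hmul N hN q (fun _ => hF0 _) x g
  | inv_of x ih =>
    -- The case of `x`, applied to the series `x⁻¹g`, is then multiplied by `-ψ(x⁻¹)`.
    have h := ih ((magnusHom (FreeGroup.of x)⁻¹ : Module.End ℤ (List X → ℤ)) g)
    rw [← Module.End.mul_apply, ← Units.val_mul, ← map_mul, mul_inv_cancel, map_one, Units.val_one,
      Module.End.one_apply] at h
    have h2 := neg_mem (hmul 0 q _ _ (hF0 (ψ (FreeGroup.of x)⁻¹ : S)) h)
    rw [Nat.zero_add] at h2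
    convert h2 using 1
    rw [mul_sub, ← mul_assoc, ← Units.val_mul, ← map_mul, inv_mul_cancel]
    simp
  | mul a b ha hb =>
    have h1 := ha ((magnusHom b : Module.End ℤ (List X → ℤ)) g)
    have h2 := hmul 0 q _ _ (hF0 (ψ a : S)) (hb g)
    rw [Nat.zero_add] at h2
    convert add_mem h1 h2 using 1
    simp only [map_mul, Units.val_mul, Module.End.mul_apply]
    noncomm_ring

omit [DecidableEq X] in
theorem magnusEval_eq_coeff_nil (q : ℕ) (g : List X → ℤ)
    (hg : ∀ I, I ≠ [] → I.length < q + 1 → g I = 0) : magnusEval N (q + 1) g = (g [] : S) := by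
  have aux : ∀ (q : ℕ) (g : List X → ℤ), (∀ I, I.length < q → g I = 0) →
      magnusEval N q g = 0 := by
    intro q
    induction q with
    | zero => intro g _; rfl
    | succ q ih =>
      intro g hg
      rw [magnusEval, hg [] (by simp), Finset.sum_eq_zero]
      · simp
      · intro x _
        rw [ih _ fun I hI => hg _ (by simpa using hI), mul_zero]
  rw [magnusEval, Finset.sum_eq_zero, add_zero]
  intro x _
  rw [aux _ _ fun I hI => hg _ (by simp) (by simpa using hI), mul_zero]

include hmul hN in
/-- An element of a free group whose Magnus coefficients vanish in the degrees `1, …, q` goes to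
`1` modulo degree `q + 1` in a filtered ring. -/
theorem mem_filtration_of_magnusCoeff_eq_zero (ψ : FreeGroup X →* Sˣ) (hF0 : ∀ s : S, s ∈ F 0)
    (hψ : ∀ x, (ψ (FreeGroup.of x) : S) = 1 + N x) (q : ℕ) (f : FreeGroup X)
    (hf : ∀ I : List X, I ≠ [] → I.length ≤ q → magnusCoeff I f = 0) :
    (ψ f : S) - 1 ∈ F (q + 1) := by
  have h := magnusEval_magnusHom F hmul N hN ψ hF0 hψ (q + 1) f magnusOne
  rw [magnusEval_eq_coeff_nil N q _ fun I hI hq => (magnusCoeff_eq I f) ▸ hf I hI (by omega),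
    ← magnusCoeff_eq, magnusCoeff_nil,
    magnusEval_eq_coeff_nil N q _ fun I hI _ => by simp [magnusOne, hI]] at h
  rw [← neg_mem_iff]
  simpa [magnusOne] using h

end Eval

end Magnus

/-! ### Vanishing of the Milnor invariants of `Zh(K)` -/

namespace GaussDiagram

theorem mu_append_singleton {m : ℕ} (L : GaussDiagram m) (J : List (Fin m)) (j : Fin m) :
    L.mu (J ++ [j]) = magnusCoeff J (L.phi (J.length + 1) (L.longitudeWord j)) := by
  simp [mu]

/-- The choice of `q > |J|` does not matter, so a single large `q` serves all short `J` at once. -/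
theorem magnusCoeff_phi {m : ℕ} (L : GaussDiagram m) (J : List (Fin m)) (k : ℕ)
    (w : FreeGroup L.Arc) :
    magnusCoeff J (L.phi (J.length + k + 1) w) = magnusCoeff J (L.phi (J.length + 1) w) :=
  magnusCoeff_eq_of_inv_mul_mem
    (L.phi_eq_phi_mod (lowerCentralSeries_le_filtrationSubgroup_magnusHom J.length) k w)

variable (K : GaussDiagram 1)

theorem zh_undersBefore_one (k : ℕ) : K.zh.undersBefore 1 k = [] := by
  rw [undersBefore, List.filterMap_eq_nil_iff]
  intro p _
  rfl

theorem zh_longitudeWord_one : K.zh.longitudeWord 1 = 1 := by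
  have h : K.zh.parallelWord 1 = 1 := by
    simp [parallelWord, partialWord, unders, zh_undersBefore_one]
  simp [longitudeWord, h, exponentSum]

theorem zh_mu_append_one {J : List (Fin 2)} (hJ : J ≠ []) : K.zh.mu (J ++ [1]) = 0 := by
  rw [mu_append_singleton, zh_longitudeWord_one, map_one, magnusCoeff_one hJ]

variable {K}

/-- By induction on length the indeterminacy is `0`, so the residue class is the integer itself. The
shorter sequences ending in `ω` contribute nothing, because `ω` never passes under and has trivial
longitude. -/
theorem zh_mu_append_zero (h : ∀ J : List (Fin 2), J ≠ [] → K.zhBar J = 0) (J : List (Fin 2))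
    (hJ : J ≠ []) : K.zh.mu (J ++ [0]) = 0 := by
  induction hn : J.length using Nat.strong_induction_on generalizing J with
  | _ n ih =>
    have hΔ : K.zh.indeterminacy (J ++ [0]) = 0 := by
      rw [indeterminacy, Finset.gcd_eq_zero_iff]
      intro I hI
      simp only [Finset.mem_biUnion, Finset.mem_filter, List.mem_toFinset] at hI
      obtain ⟨I', ⟨_, h2, hlt⟩, hI⟩ := hI
      have hlen : I.length = I'.length :=
        ((List.mem_cyclicPermutations_iff).1 hI).perm.length_eq
      have hne : I ≠ [] := by
        rintro rfl
        simp at hlen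
        omega
      obtain ⟨J', j, rfl⟩ : ∃ J' j, I = J' ++ [j] :=
        ⟨I.dropLast, I.getLast hne, (List.dropLast_append_getLast hne).symm⟩
      simp only [List.length_append, List.length_singleton] at hlen hlt
      have hJ' : J' ≠ [] := by
        rintro rfl
        simp at hlen
        omega
      rw [Int.natAbs_eq_zero]
      fin_cases j
      · exact ih J'.length (by omega) J' hJ' rfl
      · exact K.zh_mu_append_one hJ'
    have h1 := h J hJ
    rw [zhBar, muBar, ZMod.intCast_zmod_eq_zero_iff_dvd, hΔ] at h1
    simpa using h1

theorem magnusCoeff_phi_zh_longitudeWord (h : ∀ J : List (Fin 2), J ≠ [] → K.zhBar J = 0)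
    {J : List (Fin 2)} (hJ : J ≠ []) {n : ℕ} (hn : J.length ≤ n) :
    magnusCoeff J (K.zh.phi (n + 1) (K.zh.longitudeWord 0)) = 0 := by
  obtain ⟨k, rfl⟩ := Nat.exists_eq_add_of_le hn
  rw [magnusCoeff_phi, ← mu_append_singleton]
  exact zh_mu_append_zero h J hJ

end GaussDiagram

/-! ### The extended group as the link group of `Zh(K)` -/

namespace GaussDiagram

section Unders

variable {m : ℕ} (L : GaussDiagram m) (i : Fin m)

theorem undersBefore_prefix (k : ℕ) : L.undersBefore i k <+: L.unders i := by
  have h : (List.finRange (L.len i)).take (L.len i) = List.finRange (L.len i) :=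
    List.take_of_length_le (by simp)
  rw [unders, undersBefore, undersBefore, h]
  exact (List.take_prefix _ _).filterMap _

/-- The product of the letters `z ^ ε` over the undercrossings among the first `k` points of the
`i`-th component. -/
def wordBefore (k : ℕ) : FreeGroup L.Arc :=
  ((L.undersBefore i k).map fun c => FreeGroup.of (L.overArc c) ^ (L.sign c : ℤ)).prod

theorem partialWord_length_undersBefore (k : ℕ) :
    L.partialWord i (L.undersBefore i k).length = L.wordBefore i k := by
  rw [partialWord, wordBefore, ← List.prefix_iff_eq_take.1 (L.undersBefore_prefix i k)]

theorem parallelWord_eq_wordBefore : L.parallelWord i = L.wordBefore i (L.len i) :=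
  L.partialWord_length_undersBefore i _

theorem passage_eq_of_symm_eq {x : Σ i : Fin m, Fin (L.len i)} {p : L.Crossing × Strand}
    (h : L.passage.symm p = x) : L.passage x = p :=
  ((Equiv.symm_apply_eq _).1 h).symm

theorem overArc_eq_of_symm_eq {x : Σ i : Fin m, Fin (L.len i)} {c : L.Crossing}
    (h : L.passage.symm (c, Strand.over) = x) :
    L.overArc c = ⟨x.1, Fin.ofNat _ (L.undersBefore x.1 x.2).length⟩ := by
  subst h
  rfl

variable {L i}

theorem undersBefore_succ_of_under {k : Fin (L.len i)} {c : L.Crossing}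
    (h : L.passage ⟨i, k⟩ = (c, Strand.under)) :
    L.undersBefore i (k + 1) = L.undersBefore i k ++ [c] := by
  rw [undersBefore, List.take_succ_eq_append_getElem (by simp), List.filterMap_append]
  simp [h, undersBefore]

theorem undersBefore_succ_of_over {k : Fin (L.len i)} {c : L.Crossing}
    (h : L.passage ⟨i, k⟩ = (c, Strand.over)) :
    L.undersBefore i (k + 1) = L.undersBefore i k := by
  rw [undersBefore, List.take_succ_eq_append_getElem (by simp), List.filterMap_append]
  simp [h, undersBefore]

end Unders

variable (K : GaussDiagram 1)

/-- A crossing of `K`, as a crossing of `Zh(K)`. -/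
def oldCrossing (c : K.Crossing) : K.zh.Crossing := Sum.inl c

/-- The crossing of `ω` over `K` at a point of `K`. -/
def omegaCrossing (p : K.Crossing × Strand) : K.zh.Crossing := Sum.inr p

theorem zh_undersBefore_over (c : K.Crossing) :
    K.zh.undersBefore 0 (2 * (K.knotPassage.symm (c, Strand.over) + 1)) =
      K.zh.undersBefore 0 (2 * K.knotPassage.symm (c, Strand.over)) ++
        [K.omegaCrossing (c, Strand.over)] := by
  have h0 : K.zh.passage ⟨0, finProdFinEquiv (K.knotPassage.symm (c, Strand.over), 0)⟩ =
      (K.oldCrossing c, Strand.over) :=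
    K.zh.passage_eq_of_symm_eq rfl
  have h1 : K.zh.passage ⟨0, finProdFinEquiv (K.knotPassage.symm (c, Strand.over), 1)⟩ =
      (K.omegaCrossing (c, Strand.over), Strand.under) :=
    K.zh.passage_eq_of_symm_eq rfl
  have h2 := undersBefore_succ_of_over h0
  have h3 := undersBefore_succ_of_under h1
  simp only [finProdFinEquiv_apply_val, Fin.val_zero, Fin.val_one, Nat.zero_add] at h2 h3
  rw [Nat.add_comm 1] at h3
  rw [← h2, Nat.mul_add, ← h3]

theorem zh_undersBefore_under (c : K.Crossing) :
    K.zh.undersBefore 0 (2 * (K.knotPassage.symm (c, Strand.under) + 1)) =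
      K.zh.undersBefore 0 (2 * K.knotPassage.symm (c, Strand.under)) ++
        [K.omegaCrossing (c, Strand.under), K.oldCrossing c] := by
  have h0 : K.zh.passage ⟨0, finProdFinEquiv (K.knotPassage.symm (c, Strand.under), 0)⟩ =
      (K.omegaCrossing (c, Strand.under), Strand.under) :=
    K.zh.passage_eq_of_symm_eq rfl
  have h1 : K.zh.passage ⟨0, finProdFinEquiv (K.knotPassage.symm (c, Strand.under), 1)⟩ =
      (K.oldCrossing c, Strand.under) :=
    K.zh.passage_eq_of_symm_eq rfl
  have h2 := undersBefore_succ_of_under h0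
  have h3 := undersBefore_succ_of_under h1
  simp only [finProdFinEquiv_apply_val, Fin.val_zero, Fin.val_one, Nat.zero_add] at h2 h3
  rw [Nat.add_comm 1, h2, List.append_assoc] at h3
  rw [Nat.mul_add]
  exact h3

/-- Every point of `K` yields an undercrossing with `ω`, so the arc index at an earlier point never
wraps around. -/
theorem zh_length_undersBefore_lt {k : ℕ} (hk : k < K.len 0) :
    (K.zh.undersBefore 0 (2 * k)).length < (K.zh.unders 0).length := by
  have h := (K.zh.undersBefore_prefix 0 (2 * (k + 1))).length_le
  obtain ⟨⟨c, s⟩, hp⟩ := K.knotPassage.symm.surjective ⟨k, hk⟩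
  have hk' : ((K.knotPassage.symm (c, s) : Fin _) : ℕ) = k := congrArg Fin.val hp
  cases s
  · have h1 := K.zh_undersBefore_over c
    rw [hk'] at h1
    rw [h1, List.length_append, List.length_singleton] at h
    exact h
  · have h1 := K.zh_undersBefore_under c
    rw [hk'] at h1
    rw [h1, List.length_append, List.length_cons, List.length_singleton] at h
    omega

/-- The arc of `Zh(K)` that contains the beginning of the `k`-th short arc of `K`, read just before
the points `2k` and `2k+1` of the first component. -/
def zhArc (k : ℕ) : K.zh.Arc := ⟨0, Fin.ofNat _ (K.zh.undersBefore 0 (2 * k)).length⟩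

theorem zhArc_zero : K.zhArc 0 = K.zh.initialArc 0 := by
  simp [zhArc, initialArc, undersBefore]

theorem partialWord_zhArc {k : ℕ} (hk : k < K.len 0) :
    K.zh.partialWord (K.zhArc k).1 (K.zhArc k).2 = K.zh.wordBefore 0 (2 * k) := by
  rw [← partialWord_length_undersBefore]
  congr 1
  have := K.zh_length_undersBefore_lt hk
  exact Nat.mod_eq_of_lt (show _ < (K.zh.unders 0).length - 1 + 1 by omega)

theorem zh_overArc_inl (c : K.Crossing) :
    K.zh.overArc (K.oldCrossing c) = K.zhArc (K.knotPassage.symm (c, Strand.over)) := by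
  have h : K.zh.passage.symm (K.oldCrossing c, Strand.over) =
    ⟨0, finProdFinEquiv (K.knotPassage.symm (c, Strand.over), 0)⟩ := rfl
  have h2 : ((finProdFinEquiv (K.knotPassage.symm (c, Strand.over), (0 : Fin 2)) : Fin _) : ℕ) =
    2 * K.knotPassage.symm (c, Strand.over) := by simp
  rw [K.zh.overArc_eq_of_symm_eq h, zhArc, ← h2]

theorem zh_overArc_inr (p : K.Crossing × Strand) :
    K.zh.overArc (K.omegaCrossing p) = K.zh.initialArc 1 := by
  have h : K.zh.passage.symm (K.omegaCrossing p, Strand.over) = ⟨1, K.knotPassage.symm p⟩ := by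
    rcases p with ⟨c, _ | _⟩ <;> rfl
  rw [K.zh.overArc_eq_of_symm_eq h]
  simp only [zh_undersBefore_one]
  rfl

/-- The word `w` in the relator of the extended group at a passage. -/
def extWord : K.Crossing × Strand → FreeGroup K.ExtGen
  | (c, Strand.over) => FreeGroup.of none ^ (-(K.sign c : ℤ))
  | (c, Strand.under) =>
      FreeGroup.of none ^ (K.sign c : ℤ) * K.arcIn (c, Strand.over) ^ (K.sign c : ℤ)

theorem extRelator_eq (p : K.Crossing × Strand) :
    K.extRelator p = (K.arcOut p)⁻¹ * (K.extWord p)⁻¹ * K.arcIn p * K.extWord p := by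
  rcases p with ⟨c, _ | _⟩ <;> rfl

/-- Milnor's map on the generators of the extended group, through the arcs of `Zh(K)`. -/
def extPhi (q : ℕ) : FreeGroup K.ExtGen →* FreeGroup (Fin 2) :=
  FreeGroup.lift fun
    | some k => K.zh.phi q (FreeGroup.of (K.zhArc k))
    | none => FreeGroup.of 1

theorem extPhi_arcIn (q : ℕ) (p : K.Crossing × Strand) :
    K.extPhi q (K.arcIn p) = K.zh.phi q (FreeGroup.of (K.zhArc (K.knotPassage.symm p))) := by
  have := (K.knotPassage.symm p).2
  simp only [extPhi, arcIn, FreeGroup.lift_apply_of, Fin.val_ofNat]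
  rw [Nat.mod_eq_of_lt (by omega)]

/-- This matches the two groups: the undercrossings of `Zh(K)` at one point of `K` contribute
exactly the conjugating word of the extended relator there. On a lower strand `ω` is met first,
whence `v ^ ε` before `z ^ ε`. -/
theorem phi_wordBefore_succ (q : ℕ) (p : K.Crossing × Strand) :
    K.zh.phi q (K.zh.wordBefore 0 (2 * (K.knotPassage.symm p + 1))) =
      K.zh.phi q (K.zh.wordBefore 0 (2 * K.knotPassage.symm p)) * K.extPhi q (K.extWord p) := by
  have hv : K.extPhi q (FreeGroup.of none) = FreeGroup.of 1 := by simp [extPhi]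
  rcases p with ⟨c, _ | _⟩
  · rw [wordBefore, zh_undersBefore_over, List.map_append, List.prod_append, map_mul]
    congr 1
    rw [List.map_singleton, List.prod_singleton, zh_overArc_inr, map_zpow, phi_of_initialArc,
      extWord, map_zpow, hv]
    rfl
  · rw [wordBefore, zh_undersBefore_under, List.map_append, List.prod_append, map_mul]
    congr 1
    rw [List.map_cons, List.map_singleton, List.prod_cons, List.prod_singleton, zh_overArc_inr,
      zh_overArc_inl, map_mul, map_zpow, map_zpow, phi_of_initialArc, extWord, map_mul, map_zpow,
      map_zpow, hv, extPhi_arcIn]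
    rfl

/-- Modulo `H` the `k`-th short arc is the conjugate of `x₀` by the word read up to it, so each
relator says how this word grows. Only the return to the base point needs the longitude. -/
theorem extPhi_extRelator_mem {H : Subgroup (FreeGroup (Fin 2))} [H.Normal] {n : ℕ}
    (hH : (⊤ : Subgroup (FreeGroup (Fin 2))).lowerCentralSeries n ≤ H)
    (hl : K.zh.phi (n + 1) (K.zh.longitudeWord 0) ∈ H) (p : K.Crossing × Strand) :
    K.extPhi (n + 1) (K.extRelator p) ∈ H := by
  set π := QuotientGroup.mk' H
  set x : FreeGroup (Fin 2) := FreeGroup.of 0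
  set W : ℕ → FreeGroup (Fin 2) := fun k => K.zh.phi (n + 1) (K.zh.wordBefore 0 (2 * k)) with hW
  have harc : ∀ k < K.len 0, π (K.zh.phi (n + 1) (FreeGroup.of (K.zhArc k))) =
      (π (W k))⁻¹ * π x * π (W k) := by
    intro k hk
    have h1 : π (K.zh.phi (n + 1) (FreeGroup.of (K.zhArc k))) =
        π (K.zh.phi (n + 2) (FreeGroup.of (K.zhArc k))) :=
      QuotientGroup.eq.2 (hH (K.zh.phi_inv_mul_phi_succ_mem n _))
    rw [h1, phi_of, partialWord_zhArc K hk, map_mul, map_mul, map_inv]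
    rfl
  -- A trivial longitude makes the parallel word a power of `x`, which commutes with `x`.
  have hend : (π (W (K.len 0)))⁻¹ * π x * π (W (K.len 0)) = π x := by
    have h1 : K.zh.parallelWord 0 = K.zh.wordBefore 0 (2 * K.len 0) := by
      rw [parallelWord_eq_wordBefore, Nat.mul_comm]
      rfl
    have h2 : π (K.zh.phi (n + 1) (K.zh.longitudeWord 0)) = 1 :=
      (QuotientGroup.eq_one_iff _).2 hl
    rw [longitudeWord, h1, map_mul, map_zpow, phi_of_initialArc, map_mul, map_zpow] at h2
    have h3 : π (W (K.len 0)) = π x ^ K.zh.exponentSum 0 (K.zh.wordBefore 0 (2 * K.len 0)) := by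
      rw [zpow_neg] at h2
      exact mul_inv_eq_one.1 h2
    rw [h3]
    group
  have hin : π (K.extPhi (n + 1) (K.arcIn p)) =
      (π (W (K.knotPassage.symm p)))⁻¹ * π x * π (W (K.knotPassage.symm p)) := by
    rw [extPhi_arcIn, harc _ (K.knotPassage.symm p).2]
  have hout : π (K.extPhi (n + 1) (K.arcOut p)) =
      (π (W (K.knotPassage.symm p + 1)))⁻¹ * π x * π (W (K.knotPassage.symm p + 1)) := by
    have hk := (K.knotPassage.symm p).2
    simp only [extPhi, arcOut, FreeGroup.lift_apply_of, Fin.val_ofNat]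
    rcases Nat.lt_or_ge (K.knotPassage.symm p + 1) (K.len 0) with h | h
    · rw [Nat.mod_eq_of_lt (by omega), harc _ h]
    · have h' : (K.knotPassage.symm p + 1 : ℕ) = K.len 0 := by omega
      have h'' : K.len 0 - 1 + 1 = K.len 0 := by omega
      rw [h', h'', Nat.mod_self, zhArc_zero, phi_of_initialArc, hend]
  have hsucc : π (W (K.knotPassage.symm p + 1)) =
      π (W (K.knotPassage.symm p)) * π (K.extPhi (n + 1) (K.extWord p)) := by
    rw [← map_mul]
    exact congrArg π (K.phi_wordBefore_succ (n + 1) p)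
  refine (QuotientGroup.eq_one_iff _).1 ?_
  change π (K.extPhi (n + 1) (K.extRelator p)) = 1
  rw [extRelator_eq]
  simp only [map_mul, map_inv, hin, hout, hsucc]
  group

end GaussDiagram

/-! ### Fox derivatives and affine representations -/

/-- A derivation twisted by `χ` is determined by its values on the generators, and the Fox
derivatives are the universal coefficients. -/
theorem sum_mapDomain_foxWord {X G : Type} [DecidableEq X] [Fintype X] [CommGroup G]
    (χ : FreeGroup X →* G) (u : X → MonoidAlgebra ℤ G)
    (d : FreeGroup X → MonoidAlgebra ℤ G) (d1 : d 1 = 0) (dof : ∀ x, d (FreeGroup.of x) = u x)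
    (dmul : ∀ a b, d (a * b) = d a + MonoidAlgebra.of ℤ G (χ a) * d b) (w : List (X × Bool)) :
    ∑ x, MonoidAlgebra.mapDomainRingHom ℤ χ (foxWord x w) * u x = d (FreeGroup.mk w) := by
  have hof : ∀ f : FreeGroup X, MonoidAlgebra.mapDomainRingHom ℤ χ
      (MonoidAlgebra.of ℤ (FreeGroup X) f) = MonoidAlgebra.of ℤ G (χ f) := fun f => by simp
  have dinv : ∀ x, d (FreeGroup.of x)⁻¹ =
      -(MonoidAlgebra.of ℤ G (χ (FreeGroup.of x)⁻¹) * u x) := fun x => by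
    have h := dmul (FreeGroup.of x)⁻¹ (FreeGroup.of x)
    rw [inv_mul_cancel, d1, dof] at h
    exact eq_neg_of_add_eq_zero_left h.symm
  induction w with
  | nil => rw [← FreeGroup.one_eq_mk, d1]; simp [foxWord]
  | cons s w ih =>
    obtain ⟨y, b⟩ := s
    have e : FreeGroup.mk ((y, b) :: w) = FreeGroup.mk [(y, b)] * FreeGroup.mk w := by
      simp [FreeGroup.mul_mk]
    rw [e, dmul, ← ih]
    cases b
    · have e2 : FreeGroup.mk [(y, false)] = (FreeGroup.of y)⁻¹ := by
        simp [FreeGroup.of, FreeGroup.invRev]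
      simp only [foxWord, map_add, map_neg, map_mul, hof, apply_ite, map_zero, e2, dinv, add_mul,
        Finset.sum_add_distrib, neg_mul, ite_mul, zero_mul, mul_assoc,
        Finset.mul_sum]
      simp
    · have e2 : FreeGroup.mk [(y, true)] = FreeGroup.of y := rfl
      simp only [foxWord, map_add, map_mul, hof, apply_ite, map_zero, map_one, e2, dof, add_mul,
        Finset.sum_add_distrib, ite_mul, zero_mul, one_mul, mul_assoc, Finset.mul_sum]
      simp

theorem sum_mapDomain_foxDeriv {X G : Type} [DecidableEq X] [Fintype X] [CommGroup G]
    (χ : FreeGroup X →* G) (u : X → MonoidAlgebra ℤ G)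
    (d : FreeGroup X → MonoidAlgebra ℤ G) (d1 : d 1 = 0) (dof : ∀ x, d (FreeGroup.of x) = u x)
    (dmul : ∀ a b, d (a * b) = d a + MonoidAlgebra.of ℤ G (χ a) * d b) (f : FreeGroup X) :
    ∑ x, MonoidAlgebra.mapDomainRingHom ℤ χ (foxDeriv x f) * u x = d f := by
  rw [← FreeGroup.mk_toWord (x := f), ← sum_mapDomain_foxWord χ u d d1 dof dmul]
  simp only [foxDeriv, FreeGroup.mk_toWord]

/-! ### Minors of a matrix with a near-kernel vector -/

section Minors

variable {R : Type*} [CommRing R] [IsDomain R] {ι κ : Type*}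

open Matrix in
-- Multiplying by the adjugate puts `det A * r` in every `I ^ q`, and Krull's theorem makes the
-- intersection zero. The vector may vary with `q`; only its entry `r` must stay fixed.
theorem det_eq_zero_of_mulVec_mem_pow [IsNoetherianRing R] {n : Type*} [Fintype n] [DecidableEq n]
    (I : Ideal R) (hI : I ≠ ⊤) (A : Matrix n n R) (i : n) (r : R) (hr : r ≠ 0)
    (h : ∀ q : ℕ, ∃ u : n → R, u i = r ∧ ∀ j, (A *ᵥ u) j ∈ I ^ q) : A.det = 0 := by
  have key : A.det * r ∈ (⨅ q, I ^ q : Ideal R) := by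
    rw [Ideal.mem_iInf]
    intro q
    obtain ⟨u, rfl, hu⟩ := h q
    have e : (A.adjugate *ᵥ (A *ᵥ u)) i = A.det * u i := by
      rw [mulVec_mulVec, adjugate_mul, smul_mulVec, one_mulVec]
      rfl
    rw [← e]
    exact Ideal.sum_mem _ fun j _ => Ideal.mul_mem_left _ _ (hu j)
  rw [Ideal.iInf_pow_eq_bot_of_isDomain I hI, Ideal.mem_bot] at key
  exact (mul_eq_zero.1 key).resolve_right hr

open Matrix in
/-- If the columns `some k` of a matrix have vanishing maximal minors, and the column `none` is
dependent on them, then all minors of that size vanish. -/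
theorem det_submatrix_eq_zero_of_option [Fintype κ] {n : Type*} [Fintype n] [DecidableEq n]
    (M : Matrix ι (Option κ) R) (e : Option κ → R) (he : e none ≠ 0)
    (hM : ∀ i, ∑ x, M i x * e x = 0) (σ : n ≃ κ) (f : n → ι)
    (h : (M.submatrix f (some ∘ σ)).det = 0) (g : n → Option κ) :
    (M.submatrix f g).det = 0 := by
  -- A left kernel vector for the columns `some k` also kills the column `none`, since pairing with
  -- `e` leaves only a multiple of `e none`; it therefore works for every choice of columns.
  obtain ⟨y, hy, hy0⟩ := exists_vecMul_eq_zero_iff.2 h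
  have hsome : ∀ k : κ, ∑ i, y i * M (f i) (some k) = 0 := fun k => by
    have := congrFun hy0 (σ.symm k)
    simpa [vecMul, dotProduct] using this
  have hnone : ∑ i, y i * M (f i) none = 0 := by
    have h1 : ∑ i, y i * ∑ x, M (f i) x * e x = 0 := by simp [hM]
    simp only [Finset.mul_sum] at h1
    rw [Finset.sum_comm, Fintype.sum_option] at h1
    simp only [← mul_assoc, ← Finset.sum_mul, hsome] at h1
    simp only [zero_mul, Finset.sum_const_zero, add_zero] at h1
    exact (mul_eq_zero.1 h1).resolve_right he
  refine exists_vecMul_eq_zero_iff.1 ⟨y, hy, funext fun j => ?_⟩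
  simp only [vecMul, dotProduct, submatrix_apply, Pi.zero_apply]
  rcases hg : g j with _ | k
  · exact hnone
  · exact hsome k

end Minors

/-! ### The affine representation of the free group over `ℤ[t, t⁻¹, v, v⁻¹]` -/

/-- The augmentation ideal of `ℤ[t, t⁻¹, v, v⁻¹]`. -/
noncomputable def laurentAugmentation : Ideal LaurentTV :=
  RingHom.ker (MonoidAlgebra.lift ℤ ℤ (Multiplicative (ℤ × ℤ)) 1).toRingHom

theorem laurentAugmentation_ne_top : laurentAugmentation ≠ ⊤ := RingHom.ker_ne_top _

/-- The image of a group element in `ℤ[t, t⁻¹, v, v⁻¹]`. -/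
noncomputable abbrev laurentOf : Multiplicative (ℤ × ℤ) →* LaurentTV :=
  MonoidAlgebra.of ℤ (Multiplicative (ℤ × ℤ))

theorem laurentOf_sub_one_mem (g : Multiplicative (ℤ × ℤ)) :
    laurentOf g - 1 ∈ laurentAugmentation := by
  simp [laurentAugmentation, RingHom.mem_ker]

theorem laurentOf_sub_one_ne_zero {g : Multiplicative (ℤ × ℤ)} (hg : g ≠ 1) :
    laurentOf g - 1 ≠ 0 := by
  rw [sub_ne_zero, ← map_one laurentOf]
  exact fun h => hg (MonoidAlgebra.of_injective h)

/-- The matrices with entries in the `k`-th power of an ideal. -/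
def matrixFiltration {R : Type*} [CommRing R] (I : Ideal R) (n : Type*) (k : ℕ) :
    AddSubgroup (Matrix n n R) where
  carrier := {M | ∀ i j, M i j ∈ I ^ k}
  zero_mem' _ _ := zero_mem _
  add_mem' hA hB i j := add_mem (hA i j) (hB i j)
  neg_mem' hA i j := neg_mem (hA i j)

theorem matrixFiltration_mul {R n : Type*} [CommRing R] [Fintype n] (I : Ideal R) (i j : ℕ)
    (A B : Matrix n n R) (hA : A ∈ matrixFiltration I n i) (hB : B ∈ matrixFiltration I n j) :
    A * B ∈ matrixFiltration I n (i + j) := fun k l => by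
  rw [Matrix.mul_apply, pow_add]
  exact Ideal.sum_mem _ fun x _ => Ideal.mul_mem_mul (hA k x) (hB x l)

theorem mem_matrixFiltration_zero {R n : Type*} [CommRing R] (I : Ideal R) (A : Matrix n n R) :
    A ∈ matrixFiltration I n 0 := fun i j => by simp

/-- The affine transformation `x ↦ g x + b`. -/
noncomputable def affineUnit (g : Multiplicative (ℤ × ℤ)) (b : LaurentTV) :
    (Matrix (Fin 2) (Fin 2) LaurentTV)ˣ where
  val := !![laurentOf g, b; 0, 1]
  inv := !![laurentOf g⁻¹, -(laurentOf g⁻¹ * b); 0, 1]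
  val_inv := by
    have h : laurentOf g * laurentOf g⁻¹ = 1 := by rw [← map_mul, mul_inv_cancel, map_one]
    rw [Matrix.mul_fin_two, Matrix.one_fin_two]
    simp only [mul_neg, ← mul_assoc, h]
    simp
  inv_val := by
    have h : laurentOf g⁻¹ * laurentOf g = 1 := by rw [← map_mul, inv_mul_cancel, map_one]
    rw [Matrix.mul_fin_two, Matrix.one_fin_two, h]
    simp

/-- The abelianization of the free group on two letters, written with `t` and `v`. -/
def abelTV : FreeGroup (Fin 2) →* Multiplicative (ℤ × ℤ) :=
  FreeGroup.lift ![Multiplicative.ofAdd (1, 0), Multiplicative.ofAdd (0, 1)]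

/-- The affine representation `x₀ ↦ (x ↦ t x + (t - 1))`, `x₁ ↦ (x ↦ v x)`. -/
noncomputable def affineHom : FreeGroup (Fin 2) →* (Matrix (Fin 2) (Fin 2) LaurentTV)ˣ :=
  FreeGroup.lift ![affineUnit (Multiplicative.ofAdd (1, 0))
    (laurentOf (Multiplicative.ofAdd (1, 0)) - 1), affineUnit (Multiplicative.ofAdd (0, 1)) 0]

theorem affineHom_apply (f : FreeGroup (Fin 2)) :
    ∃ b, (affineHom f : Matrix (Fin 2) (Fin 2) LaurentTV) = !![laurentOf (abelTV f), b; 0, 1] := by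
  have hof : ∀ x : Fin 2, ∃ b, affineHom (FreeGroup.of x) =
      affineUnit (abelTV (FreeGroup.of x)) b := fun x => by
    fin_cases x
    · exact ⟨_, by simp only [affineHom, abelTV, FreeGroup.lift_apply_of]; rfl⟩
    · exact ⟨_, by simp only [affineHom, abelTV, FreeGroup.lift_apply_of]; rfl⟩
  induction f using FreeGroup.induction_on with
  | C1 => exact ⟨0, by rw [map_one, map_one, map_one, Units.val_one, Matrix.one_fin_two]⟩
  | of x =>
    obtain ⟨b, hb⟩ := hof x
    exact ⟨b, by rw [hb]; rfl⟩
  | inv_of x _ =>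
    obtain ⟨b, hb⟩ := hof x
    exact ⟨_, by rw [map_inv, map_inv, hb]; rfl⟩
  | mul f g hf hg =>
    obtain ⟨a, ha⟩ := hf
    obtain ⟨b, hb⟩ := hg
    refine ⟨laurentOf (abelTV f) * b + a, ?_⟩
    rw [map_mul, Units.val_mul, ha, hb, Matrix.mul_fin_two]
    simp only [map_mul]
    simp

/-- The translation part is a derivation twisted by abelianization, as needed to feed it to the Fox
matrix. -/
theorem affineHom_mul_apply (f g : FreeGroup (Fin 2)) :
    (affineHom (f * g) : Matrix (Fin 2) (Fin 2) LaurentTV) 0 1 =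
      (affineHom f : Matrix (Fin 2) (Fin 2) LaurentTV) 0 1 +
        laurentOf (abelTV f) * (affineHom g : Matrix (Fin 2) (Fin 2) LaurentTV) 0 1 := by
  obtain ⟨a, ha⟩ := affineHom_apply f
  obtain ⟨b, hb⟩ := affineHom_apply g
  rw [map_mul, Units.val_mul, ha, hb, Matrix.mul_fin_two]
  simp [add_comm]

theorem affineHom_of_zero : (affineHom (FreeGroup.of 0) : Matrix (Fin 2) (Fin 2) LaurentTV) 0 1 =
    laurentOf (Multiplicative.ofAdd (1, 0)) - 1 := by
  simp only [affineHom, FreeGroup.lift_apply_of]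
  rfl

theorem affineHom_of_one :
    (affineHom (FreeGroup.of 1) : Matrix (Fin 2) (Fin 2) LaurentTV) 0 1 = 0 := by
  simp only [affineHom, FreeGroup.lift_apply_of]
  rfl

theorem affineHom_of_sub_one_mem (x : Fin 2) :
    (affineHom (FreeGroup.of x) : Matrix (Fin 2) (Fin 2) LaurentTV) - 1 ∈
      matrixFiltration laurentAugmentation (Fin 2) 1 := by
  intro i j
  obtain ⟨b, hb⟩ := affineHom_apply (FreeGroup.of x)
  have hb' : b ∈ laurentAugmentation := by
    have h : b = (affineHom (FreeGroup.of x) : Matrix (Fin 2) (Fin 2) LaurentTV) 0 1 := by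
      rw [hb]; rfl
    rw [h]
    fin_cases x
    · exact affineHom_of_zero ▸ laurentOf_sub_one_mem _
    · exact affineHom_of_one ▸ zero_mem _
  rw [hb, pow_one, Matrix.one_fin_two]
  fin_cases i <;> fin_cases j
  · exact laurentOf_sub_one_mem _
  · simpa using hb'
  · simp
  · simp

theorem affineHom_sub_one_mem_of_magnusCoeff_eq_zero (q : ℕ) (f : FreeGroup (Fin 2))
    (hf : ∀ I : List (Fin 2), I ≠ [] → I.length ≤ q → magnusCoeff I f = 0) :
    (affineHom f : Matrix (Fin 2) (Fin 2) LaurentTV) - 1 ∈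
      matrixFiltration laurentAugmentation (Fin 2) (q + 1) :=
  mem_filtration_of_magnusCoeff_eq_zero _ (matrixFiltration_mul _)
    (fun x => (affineHom (FreeGroup.of x) : Matrix (Fin 2) (Fin 2) LaurentTV) - 1)
    affineHom_of_sub_one_mem affineHom (mem_matrixFiltration_zero _)
    (fun _ => (add_sub_cancel _ _).symm) q f hf

namespace GaussDiagram

/-! ### The generalized Alexander polynomial -/

variable (K : GaussDiagram 1)

theorem abelTV_extPhi (q : ℕ) (f : FreeGroup K.ExtGen) :
    abelTV (K.extPhi (q + 2) f) = K.extAbel f := by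
  suffices h : abelTV.comp (K.extPhi (q + 2)) = K.extAbel from DFunLike.congr_fun h f
  refine FreeGroup.ext_hom _ _ fun x => ?_
  rcases x with _ | k
  · simp [extPhi, extAbel, abelTV]
  · simp only [MonoidHom.comp_apply, extPhi, extAbel, FreeGroup.lift_apply_of, phi_of, map_mul,
      map_inv]
    rw [mul_comm, mul_inv_cancel_left]
    simp [abelTV, zhArc]

theorem extAbel_extRelator (p : K.Crossing × Strand) : K.extAbel (K.extRelator p) = 1 := by
  rw [extRelator_eq]
  simp only [map_mul, map_inv, arcIn, arcOut, extAbel, FreeGroup.lift_apply_of]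
  rw [mul_assoc, mul_right_comm, mul_assoc]
  simp

/-- The fundamental formula of Fox calculus: `f ↦ χ(f) - 1` is a derivation that vanishes on
relators. -/
theorem sum_extAlexanderMatrix_mul_sub_one (p : K.Crossing × Strand) :
    ∑ x, K.extAlexanderMatrix p x * (laurentOf (K.extAbel (FreeGroup.of x)) - 1) = 0 := by
  have h := sum_mapDomain_foxDeriv K.extAbel
    (fun x => laurentOf (K.extAbel (FreeGroup.of x)) - 1) (fun f => laurentOf (K.extAbel f) - 1)
    (by rw [map_one, map_one, sub_self]) (fun _ => rfl)
    (fun a b => by rw [map_mul, map_mul]; ring) (K.extRelator p)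
  refine h.trans ?_
  rw [extAbel_extRelator, map_one, sub_self]

variable {K}

theorem exists_sum_extAlexanderMatrix_mem (h : ∀ J : List (Fin 2), J ≠ [] → K.zhBar J = 0)
    (q : ℕ) : ∃ u : K.ExtGen → LaurentTV, u none = 0 ∧
      u (some 0) = laurentOf (Multiplicative.ofAdd (1, 0)) - 1 ∧
      ∀ p, ∑ x, K.extAlexanderMatrix p x * u x ∈ laurentAugmentation ^ q := by
  let d : FreeGroup K.ExtGen → LaurentTV := fun f =>
    (affineHom (K.extPhi (q + 2) f) : Matrix (Fin 2) (Fin 2) LaurentTV) 0 1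
  refine ⟨fun x => d (FreeGroup.of x), ?_, ?_, fun p => ?_⟩
  · simp only [d, extPhi, FreeGroup.lift_apply_of]
    exact affineHom_of_one
  · simp only [d, extPhi, FreeGroup.lift_apply_of, Fin.val_zero, zhArc_zero, phi_of_initialArc]
    exact affineHom_of_zero
  · have h1 := sum_mapDomain_foxDeriv K.extAbel (fun x => d (FreeGroup.of x)) d
      (by simp [d]) (fun _ => rfl)
      (fun a b => by
        simp only [d]
        rw [map_mul (K.extPhi (q + 2)), affineHom_mul_apply, abelTV_extPhi]) (K.extRelator p)
    change ∑ x, MonoidAlgebra.mapDomainRingHom ℤ K.extAbel (foxDeriv x (K.extRelator p)) *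
      d (FreeGroup.of x) ∈ _
    rw [h1]
    -- The subgroup `H` consists of the elements acting trivially modulo `I ^ (q + 2)`. Level `q +
    -- 2` rather than `q` is used because `abelTV_extPhi` needs an index of at least two.
    have := filtrationSubgroup_normal (matrixFiltration laurentAugmentation (Fin 2))
      (matrixFiltration_mul _) affineHom (fun _ => mem_matrixFiltration_zero _ _) (q + 2)
    have h2 := K.extPhi_extRelator_mem
      (lowerCentralSeries_le_filtrationSubgroup (matrixFiltration laurentAugmentation (Fin 2))
        (matrixFiltration_mul _) affineHom (fun _ => mem_matrixFiltration_zero _ _)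
        -- In degree bound `0` the coefficient condition is vacuous, so every element acts trivially
        -- modulo `I`.
        (fun f => affineHom_sub_one_mem_of_magnusCoeff_eq_zero 0 f fun I hI h0 =>
          absurd (List.length_eq_zero_iff.1 (Nat.le_zero.1 h0)) hI) (q + 1))
      (affineHom_sub_one_mem_of_magnusCoeff_eq_zero (q + 1) _ fun I hI hq =>
        magnusCoeff_phi_zh_longitudeWord h hI hq) p
    have h3 : d (K.extRelator p) ∈ laurentAugmentation ^ (q + 2) := by
      simpa [mem_filtrationSubgroup] using h2 0 1
    exact Ideal.pow_le_pow_right (Nat.le_add_right q 2) h3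

end GaussDiagram

theorem mainTheorem5 (K : GaussDiagram 1)
    (h : ∀ J : List (Fin 2), J ≠ [] → K.zhBar J = 0) :
    ∀ Δ : LaurentTV, K.IsGeneralizedAlexanderPolynomial Δ ↔ Δ = 0 := by
  have : Algebra.FiniteType ℤ LaurentTV := inferInstance
  have : IsNoetherianRing LaurentTV := Algebra.FiniteType.isNoetherianRing ℤ LaurentTV
  have ht : laurentOf (Multiplicative.ofAdd (1, 0)) - 1 ≠ 0 :=
    laurentOf_sub_one_ne_zero (by decide)
  have hv : laurentOf (K.extAbel (FreeGroup.of none)) - 1 ≠ 0 :=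
    laurentOf_sub_one_ne_zero (by simp [GaussDiagram.extAbel])
  let σ : Fin (Fintype.card K.ExtGen - 1) ≃ K.ShortArc := finCongr (by simp)
  have hdet : ∀ f g, (K.extAlexanderMatrix.submatrix (l := Fin (Fintype.card K.ExtGen - 1))
      (o := Fin (Fintype.card K.ExtGen - 1)) f g).det = 0 := by
    intro f g
    refine det_submatrix_eq_zero_of_option _ _ hv K.sum_extAlexanderMatrix_mul_sub_one σ f ?_ g
    -- The fixed coordinate is the first short arc, with value `t - 1` for every `q`. Since the
    -- entry at `v` is `0`, dropping that column loses nothing.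
    refine det_eq_zero_of_mulVec_mem_pow _ laurentAugmentation_ne_top _ (σ.symm 0) _ ht fun q => ?_
    obtain ⟨u, hnone, hzero, hu⟩ := GaussDiagram.exists_sum_extAlexanderMatrix_mem h q
    refine ⟨u ∘ some ∘ σ, by simpa using hzero, fun j => ?_⟩
    have h1 := hu (f j)
    rw [Fintype.sum_option, hnone, mul_zero, zero_add, ← Equiv.sum_comp σ] at h1
    exact h1
  intro Δ
  constructor
  · intro hΔ
    exact zero_dvd_iff.1 ((hΔ 0).2 fun f g => (hdet f g).symm ▸ dvd_rfl)
  · rintro rfl d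
    exact ⟨fun _ f g => (hdet f g).symm ▸ dvd_zero d, fun _ => dvd_zero d⟩
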